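/- For real $\mu,\eta$ consider the system for $\gamma=(\gamma_0,\dots,\gamma_6)\in\mathbb R^7$ $$ \begin{aligned} 2\gamma_0\gamma_6&=-\tfrac13\mu,\\ 2\gamma_0\gamma_5+2\gamma_1\gamma_6&=\tfrac13\eta\mu+\tfrac52\mu,\\ 2\gamma_0\gamma_4+2\gamma_1\gamma_5+2\gamma_2\gamma_6&=-\tfrac52\eta\mu-\tfrac{17}2\mu,\\ 2\gamma_0\gamma_3+2\gamma_1\gamma_4+2\gamma_2\gamma_5+2\gamma_3\gamma_6&=\tfrac{17}2\eta\mu+\tfrac{46}3\mu-\tfrac13,\\ 2\gamma_0\gamma_2+2\gamma_1\gamma_3+2\gamma_2\gamma_4+2\gamma_3\gamma_5+2\gamma_4\gamma_6&=-\tfrac{46}3\eta\mu+\tfrac13\eta-\tfrac{29}2\mu+\tfrac32,\\ 2\gamma_0\gamma_1+2\gamma_1\gamma_2+2\gamma_2\gamma_3+2\gamma_3\gamma_4+2\gamma_4\gamma_5+2\gamma_5\gamma_6&=\tfrac{29}2\eta\mu-\tfrac{10}3\eta+\tfrac{11}2\mu-3,\\ \gamma_0^2+\gamma_1^2+\dots+\gamma_6^2&=-\tfrac{11}2\eta\mu+3\eta+\tfrac{11}6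 . \end{aligned}\tag{S} $$ Let $G=G(\mu,\eta,\gamma)$ be the symmetric matrix $G=A+\mu B+\eta C+\eta\mu D-LL^{\top}\in\mathbb R^{6\times6}$, where * $A$ is the symmetric Toeplitz matrix with first row $(\tfrac{11}6,-\tfrac32,\tfrac34,-\tfrac16,0,0)$, * $B$ is the symmetric Toeplitz matrix with first row $(0,\tfrac{11}4,-\tfrac{29}4,\tfrac{23}3,-\tfrac{17}4,\tfrac54)$, * $C$ has $C_{12}=C_{21}=-\tfrac{11}{12}$, all other entries in its first row and column $0$, and as lower right $5\times5$ block the symmetric Toeplitz matrix with first row $(3,-\tfrac53,\tfrac16,0,0)$, * $D$ has first row and column $0$ and as lower right $5\times5$ block the symmetric Toeplitz matrix with first row $(-\tfrac{11}2,\tfrac{29}4,-\tfrac{23}3,\tfrac{17}4,-\tfrac54)$, * $L$ is the lower triangular Toeplitz matrix with first column $(\gamma_0,\dots,\gamma_5)^{\top}$. Then the following hold. 1. Every real solution of (S) satisfies $(\gamma_1+\gamma_3+\gamma_5)^2=\tfrac53(1+\eta)(1-7\mu)$. If $\eta\ge0$ and $\mu>\tfrac17$, then (S) has no real solution. 2.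 There is $\eta\in[0,1)$ such that for every $\mu\in[0,\tfrac17]$ the system (S) has a real solution $\gamma$ for which $G(\mu,\eta,\gamma)$ is positive definite. 3. Let $\mathcal X$ be a real Hilbert space, $\tau>0$ and $0<\omega\le\tfrac17$. For a sequence $(y^n)_{n\in\mathbb Z}$ in $\mathcal X$ put $$\partial_\tau y^n=\tfrac1\tau\big(\tfrac{11}6y^n-3y^{n-1}+\tfrac32y^{n-2}-\tfrac13y^{n-3}\big),\qquad \Delta(y^n)=3y^{n-1}-3y^{n-2}+y^{n-3},$$ and $Y^n=(y^n,y^{n-1},\dots,y^{n-5})\in\mathcal X^6$; for a symmetric positive definite $G\in\mathbb R^{6\times 6}$ put $\|Y\|_G^2=\langle GY,Y\rangle_{\mathcal X^6}$. Then there exist $\eta\in[0,1)$ and families $G(\mu)\in\mathbb R^{6\times6}$, $\gamma(\mu)\in\mathbb R^7$ such that for every $\mu\in[0,\omega]$ the matrix $G(\mu)$ is symmetric positive definite and, for every sequence $(y^n)_{n\in\mathbb Z}$ in $\mathcal X$ and every $n\in\mathbb Z$, $$\big\langle \tau\partial_\tau y^n+\mu\,\Delta(\tau\partial_\tau y^n),\;y^n-\eta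 y^{n-1}\big\rangle_{\mathcal X}=\|Y^n\|_{G(\mu)}^2-\|Y^{n-1}\|_{G(\mu)}^2+\Big\|\sum_{i=0}^6\gamma_i(\mu)\,y^{n-i}\Big\|_{\mathcal X}^2 ,$$ and moreover the infimum over $\mu\in[0,\omega]$ of the eigenvalues of $G(\mu)$ is positive and their supremum is finite. -/

import Mathlib

/-! BDF operators, discrete delay operators and the summation (G-stability) assumption. -/

/-- The coefficients `ξ_{k,ℓ}` of the `k`-step backward differentiation formula, i.e. the
coefficient of `z ^ ℓ` in `∑_{j=1}^k (1 - z) ^ j / j`.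
For `k = 3` these are `11/6, -3, 3/2, -1/3`. -/
noncomputable def bdfCoeff (k ℓ : ℕ) : ℝ :=
  ∑ j ∈ Finset.Icc 1 k, (1 / (j : ℝ)) * ((-1) ^ ℓ * (j.choose ℓ : ℝ))

/-- The delay coefficients `c_{δ,ℓ} = (-1) ^ (ℓ - 1) * binom δ ℓ`, for `1 ≤ ℓ ≤ δ`.
For `δ = 3` these are `3, -3, 1`. -/
def delayCoeff (δ ℓ : ℕ) : ℝ := (-1) ^ (ℓ - 1) * (δ.choose ℓ : ℝ)

section Operators

variable {X : Type*} [NormedAddCommGroup X] [InnerProductSpace ℝ X]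

/-- The BDF-`k` operator with step size `τ`:
`(∂ y)^n = (1 / τ) ∑_{ℓ=0}^k ξ_{k,ℓ} y^{n-ℓ}`. -/
noncomputable def bdf (k : ℕ) (τ : ℝ) (y : ℤ → X) (n : ℤ) : X :=
  (1 / τ) • ∑ ℓ ∈ Finset.range (k + 1), bdfCoeff k ℓ • y (n - (ℓ : ℤ))

/-- The discrete delay operator `(D y)^n = ∑_{ℓ=1}^δ c_{δ,ℓ} y^{n-ℓ}`. -/
noncomputable def discreteDelay (δ : ℕ) (y : ℤ → X) (n : ℤ) : X :=
  ∑ ℓ ∈ Finset.Icc 1 δ, delayCoeff δ ℓ • y (n - (ℓ : ℤ))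

/-- The stacked vector `Y^n = (y^n, y^{n-1}, …, y^{n-s+1}) ∈ X^s`. -/
def stacked (s : ℕ) (y : ℤ → X) (n : ℤ) : Fin s → X := fun i => y (n - (i : ℤ))

/-- The square of the weighted norm, `‖Y‖_G² = ⟨G Y, Y⟩` in `X^s`. -/
noncomputable def weightedNormSq {s : ℕ} (G : Matrix (Fin s) (Fin s) ℝ) (Y : Fin s → X) : ℝ :=
  ∑ i, inner ℝ (∑ j, G i j • Y j) (Y i)

end Operators

/-- The summation identity
`⟨τ ∂y^n + μ D(τ ∂y^n), y^n - η y^{n-1}⟩ = ‖Y^n‖_G² - ‖Y^{n-1}‖_G² + ‖∑_i γ_i y^{n-i}‖²`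
for all sequences `(y^n)_{n ∈ ℤ}` in `X` and all `n`. -/
def SummationIdentity (X : Type*) [NormedAddCommGroup X] [InnerProductSpace ℝ X]
    (k δ : ℕ) (τ η μ : ℝ) (G : Matrix (Fin (k + δ)) (Fin (k + δ)) ℝ)
    (γ : Fin (k + δ + 1) → ℝ) : Prop :=
  ∀ (y : ℤ → X) (n : ℤ),
    inner ℝ (τ • bdf k τ y n + μ • discreteDelay δ (fun m => τ • bdf k τ y m) n)
        (y n - η • y (n - 1)) =
      weightedNormSq G (stacked (k + δ) y n) - weightedNormSq G (stacked (k + δ) y (n - 1))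
        + ‖∑ i, γ i • y (n - (i : ℤ))‖ ^ 2

/-- The summation assumption, for the multiplier `η` and the families `G(μ)` and `γ(μ)`:
`η ∈ [0, 1)` and, for each `μ ∈ [0, ω]`, `G(μ)` is symmetric positive definite and
the summation identity holds with `G(μ)` and `γ(μ)`. -/
def SummationAssumption (X : Type*) [NormedAddCommGroup X] [InnerProductSpace ℝ X]
    (k δ : ℕ) (ω τ η : ℝ) (G : ℝ → Matrix (Fin (k + δ)) (Fin (k + δ)) ℝ)
    (γ : ℝ → Fin (k + δ + 1) → ℝ) : Prop :=
  (0 ≤ η ∧ η < 1) ∧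
    ∀ μ ∈ Set.Icc (0 : ℝ) ω, (G μ).PosDef ∧ SummationIdentity X k δ τ η μ (G μ) (γ μ)

/-- All eigenvalues of the matrices `G(μ)`, `μ ∈ [0, ω]`. -/
def eigenvalueSet {s : ℕ} (ω : ℝ) (G : ℝ → Matrix (Fin s) (Fin s) ℝ) : Set ℝ :=
  {l | ∃ μ ∈ Set.Icc (0 : ℝ) ω, Module.End.HasEigenvalue (Matrix.toLin' (G μ)) l}

/-- The eigenvalues of `G(μ)`, `μ ∈ [0, ω]`, have positive infimum and finite supremum. -/
def UniformEigenvalueBounds {s : ℕ} (ω : ℝ) (G : ℝ → Matrix (Fin s) (Fin s) ℝ) : Prop :=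
  0 < sInf (eigenvalueSet ω G) ∧ BddAbove (eigenvalueSet ω G)

/-- The nonlinear system for `γ_0, …, γ_6` in the case `k = δ = 3`. -/
def BDF3System (μ η : ℝ) (γ : Fin 7 → ℝ) : Prop :=
  2 * γ 0 * γ 6 = -(1 / 3) * μ ∧
  2 * γ 0 * γ 5 + 2 * γ 1 * γ 6 = 1 / 3 * η * μ + 5 / 2 * μ ∧
  2 * γ 0 * γ 4 + 2 * γ 1 * γ 5 + 2 * γ 2 * γ 6 = -(5 / 2) * η * μ - 17 / 2 * μ ∧
  2 * γ 0 * γ 3 + 2 * γ 1 * γ 4 + 2 * γ 2 * γ 5 + 2 * γ 3 * γ 6 =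
    17 / 2 * η * μ + 46 / 3 * μ - 1 / 3 ∧
  2 * γ 0 * γ 2 + 2 * γ 1 * γ 3 + 2 * γ 2 * γ 4 + 2 * γ 3 * γ 5 + 2 * γ 4 * γ 6 =
    -(46 / 3) * η * μ + 1 / 3 * η - 29 / 2 * μ + 3 / 2 ∧
  2 * γ 0 * γ 1 + 2 * γ 1 * γ 2 + 2 * γ 2 * γ 3 + 2 * γ 3 * γ 4 + 2 * γ 4 * γ 5
      + 2 * γ 5 * γ 6 =
    29 / 2 * η * μ - 10 / 3 * η + 11 / 2 * μ - 3 ∧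
  γ 0 ^ 2 + γ 1 ^ 2 + γ 2 ^ 2 + γ 3 ^ 2 + γ 4 ^ 2 + γ 5 ^ 2 + γ 6 ^ 2 =
    -(11 / 2) * η * μ + 3 * η + 11 / 6

/-- The lower triangular Toeplitz matrix with first column `(γ_0, …, γ_5)`. -/
def bdf3L (γ : Fin 7 → ℝ) : Matrix (Fin 6) (Fin 6) ℝ :=
  !![γ 0, 0, 0, 0, 0, 0;
     γ 1, γ 0, 0, 0, 0, 0;
     γ 2, γ 1, γ 0, 0, 0, 0;
     γ 3, γ 2, γ 1, γ 0, 0, 0;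
     γ 4, γ 3, γ 2, γ 1, γ 0, 0;
     γ 5, γ 4, γ 3, γ 2, γ 1, γ 0]

/-- The `6 × 6` matrix `G` belonging to `μ`, `η` and `γ` in the case `k = δ = 3`. -/
noncomputable def bdf3G (μ η : ℝ) (γ : Fin 7 → ℝ) : Matrix (Fin 6) (Fin 6) ℝ :=
  !![11/6, -3/2, 3/4, -1/6, 0, 0;
     -3/2, 11/6, -3/2, 3/4, -1/6, 0;
     3/4, -3/2, 11/6, -3/2, 3/4, -1/6;
     -1/6, 3/4, -3/2, 11/6, -3/2, 3/4;
     0, -1/6, 3/4, -3/2, 11/6, -3/2;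
     0, 0, -1/6, 3/4, -3/2, 11/6]
  + μ • !![0, 11/4, -29/4, 23/3, -17/4, 5/4;
           11/4, 0, 11/4, -29/4, 23/3, -17/4;
           -29/4, 11/4, 0, 11/4, -29/4, 23/3;
           23/3, -29/4, 11/4, 0, 11/4, -29/4;
           -17/4, 23/3, -29/4, 11/4, 0, 11/4;
           5/4, -17/4, 23/3, -29/4, 11/4, 0]
  + η • !![0, -11/12, 0, 0, 0, 0;
           -11/12, 3, -5/3, 1/6, 0, 0;
           0, -5/3, 3, -5/3, 1/6, 0;
           0, 1/6, -5/3, 3, -5/3, 1/6;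
           0, 0, 1/6, -5/3, 3, -5/3;
           0, 0, 0, 1/6, -5/3, 3]
  + (η * μ) • !![0, 0, 0, 0, 0, 0;
                 0, -11/2, 29/4, -23/3, 17/4, -5/4;
                 0, 29/4, -11/2, 29/4, -23/3, 17/4;
                 0, -23/3, 29/4, -11/2, 29/4, -23/3;
                 0, 17/4, -23/3, 29/4, -11/2, 29/4;
                 0, -5/4, 17/4, -23/3, 29/4, -11/2]
  - bdf3L γ * (bdf3L γ).transpose

/-!
# Summation identity for the BDF-3 method with discrete delay

Put `Γ(z) = ∑ γ_i z ^ i`. The system says that `Γ(z) Γ(1/z)` equals the symmetrization of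
`α(z) (1 + μ d(z)) (1 - η / z)`, with `α` the BDF-3 polynomial and `d(z) = 1 - (1 - z) ^ 3`. At
`z = 1` this gives `Γ(1) = 0`, and at `z = -1` it gives the identity for `γ_1 + γ_3 + γ_5` and thus
the necessity of `μ ≤ 1/7` (`BDF3System.sq_odd_coeff_sum`).

For solvability the multiplier `η = 1/2` serves all `μ ∈ [0, 1/7]` at once. The right-hand side is
then `q(cos θ)` with an explicit polynomial `q`, positive on `(-1, 1)`
(`eval_bdf3Symbol_pos`), and the Fejér–Riesz theorem (`exists_isOuterFactor`) provides `Γ`. It is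
chosen with all zeros in the closed unit disc, because this bounds `γ_6` away from `0` uniformly in
`μ`, even at `μ = 0` where `γ_0 γ_6 = 0` (`exists_bdf3System`).

The summation identity holds for every solution of the system, by comparison of coefficients
(`BDF3System.energy_identity`). Continuing a vector `v ∈ ℝ⁶` by `y^n = y^{n-1} / 2` makes its
left-hand side vanish, so that the quadratic form of `G` at `v` is a sum of squares of the residuals
`∑ γ_i y^{n-i}` (`BDF3System.weightedNormSq_eq`). These residuals vanish simultaneously only for
`v = 0`, since `γ_6 ≠ 0` and `Γ(2) ≠ 0`. Hence `G` is positive definite, and compactness of the set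
of admissible `(μ, γ)` makes the eigenvalue bounds uniform (`exists_uniform_bounds`); no continuous
dependence of `γ` on `μ` is needed.
-/

/-! ### The values of `Γ` at `1` and `-1` -/

/-- The polynomial `Γ(z) = ∑ γ_i z ^ i` vanishes at `z = 1`, because the right-hand sides of the
system add up to `0`: this is the consistency of the BDF formula. -/
theorem BDF3System.coeff_sum_eq_zero {μ η : ℝ} {γ : Fin 7 → ℝ} (h : BDF3System μ η γ) :
    γ 0 + γ 1 + γ 2 + γ 3 + γ 4 + γ 5 + γ 6 = 0 := by
  obtain ⟨h6, h5, h4, h3, h2, h1, h0⟩ := h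
  refine pow_eq_zero_iff two_ne_zero |>.1 ?_
  linear_combination h0 + h1 + h2 + h3 + h4 + h5 + h6

/-- The alternating sum of the equations computes `Γ(-1) ^ 2`, and `Γ(1) = 0` turns `Γ(-1)` into
`-2 (γ_1 + γ_3 + γ_5)`. -/
theorem BDF3System.sq_odd_coeff_sum {μ η : ℝ} {γ : Fin 7 → ℝ} (h : BDF3System μ η γ) :
    (γ 1 + γ 3 + γ 5) ^ 2 = 5 / 3 * (1 + η) * (1 - 7 * μ) := by
  have hs := h.coeff_sum_eq_zero
  obtain ⟨h6, h5, h4, h3, h2, h1, h0⟩ := h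
  linear_combination (1 / 4) * (h0 - h1 + h2 - h3 + h4 - h5 + h6) +
    (1 / 4) * (3 * (γ 1 + γ 3 + γ 5) - (γ 0 + γ 2 + γ 4 + γ 6)) * hs

/-! ### Weighted norms and the summation identity -/

section Energy

variable {X : Type*} [NormedAddCommGroup X] [InnerProductSpace ℝ X]

theorem weightedNormSq_eq_sum {s : ℕ} (G : Matrix (Fin s) (Fin s) ℝ) (Y : Fin s → X) :
    weightedNormSq G Y = ∑ i, ∑ j, G i j * inner ℝ (Y j) (Y i) := by
  simp [weightedNormSq, sum_inner, real_inner_smul_left]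

theorem weightedNormSq_mul_transpose {s : ℕ} (L : Matrix (Fin s) (Fin s) ℝ) (Y : Fin s → X) :
    weightedNormSq (L * L.transpose) Y = ∑ k, ‖∑ i, L i k • Y i‖ ^ 2 := by
  simp only [weightedNormSq_eq_sum, Matrix.mul_apply, Matrix.transpose_apply,
    ← real_inner_self_eq_norm_sq, sum_inner, inner_sum, real_inner_smul_left,
    real_inner_smul_right, Finset.sum_mul]
  rw [Finset.sum_comm]
  conv_rhs => rw [Finset.sum_comm]
  refine Finset.sum_congr rfl fun i _ => ?_
  conv_rhs => rw [Finset.sum_comm]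
  refine Finset.sum_congr rfl fun j _ => Finset.sum_congr rfl fun k _ => ?_
  rw [real_inner_comm]
  ring

theorem weightedNormSq_sub {s : ℕ} (G H : Matrix (Fin s) (Fin s) ℝ) (Y : Fin s → X) :
    weightedNormSq (G - H) Y = weightedNormSq G Y - weightedNormSq H Y := by
  simp [weightedNormSq_eq_sum, sub_mul]

theorem weightedNormSq_smul {s : ℕ} (G : Matrix (Fin s) (Fin s) ℝ) (c : ℝ) (Y : Fin s → X) :
    weightedNormSq G (c • Y) = c ^ 2 * weightedNormSq G Y := by
  simp only [weightedNormSq_eq_sum, Pi.smul_apply, real_inner_smul_left, real_inner_smul_right,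
    Finset.mul_sum]
  refine Finset.sum_congr rfl fun i _ => Finset.sum_congr rfl fun j _ => ?_
  ring

theorem smul_bdf_three {τ : ℝ} (hτ : τ ≠ 0) (y : ℤ → X) (n : ℤ) :
    τ • bdf 3 τ y n =
      (11 / 6 : ℝ) • y n - (3 : ℝ) • y (n - 1) + (3 / 2 : ℝ) • y (n - 2)
        - (1 / 3 : ℝ) • y (n - 3) := by
  have hI : Finset.Icc 1 3 = ({1, 2, 3} : Finset ℕ) := by decide
  have h0 : bdfCoeff 3 0 = 11 / 6 := by norm_num [bdfCoeff, hI]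
  have h1 : bdfCoeff 3 1 = -3 := by norm_num [bdfCoeff, hI]
  have h2 : bdfCoeff 3 2 = 3 / 2 := by norm_num [bdfCoeff, hI, Nat.choose]
  have h3 : bdfCoeff 3 3 = -(1 / 3) := by norm_num [bdfCoeff, hI, Nat.choose]
  rw [bdf, smul_smul, mul_one_div_cancel hτ, one_smul]
  simp only [Finset.sum_range_succ, Finset.sum_range_zero, h0, h1, h2, h3]
  push_cast
  simp only [sub_zero]
  module

theorem discreteDelay_three (y : ℤ → X) (n : ℤ) :
    discreteDelay 3 y n =
      (3 : ℝ) • y (n - 1) - (3 : ℝ) • y (n - 2) + y (n - 3) := by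
  have hI : Finset.Icc 1 3 = ({1, 2, 3} : Finset ℕ) := by decide
  simp [discreteDelay, hI, delayCoeff, Nat.choose]
  module

/-- The summation identity. Both sides are quadratic forms in `y^n, …, y^{n-6}`; the matrix `G` is
built so that all coefficients agree except possibly those of `⟨y^{n-6+k}, y^{n-6}⟩`, and these
agree by the equations of the system. -/
theorem BDF3System.energy_identity {μ η : ℝ} {γ : Fin 7 → ℝ} (h : BDF3System μ η γ)
    {τ : ℝ} (hτ : τ ≠ 0) : SummationIdentity X 3 3 τ η μ (bdf3G μ η γ) γ := by
  intro y n
  have hb := smul_bdf_three hτ y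
  obtain ⟨h6, h5, h4, h3, h2, h1, h0⟩ := h
  rw [discreteDelay_three]
  simp only [hb]
  unfold bdf3G
  rw [weightedNormSq_sub, weightedNormSq_sub, weightedNormSq_mul_transpose,
    weightedNormSq_mul_transpose]
  have e1 : ∀ k : Fin 6, stacked (X := X) 6 y n k = y (n - (k : ℤ)) := fun _ => rfl
  have e2 : ∀ k : Fin 6, stacked (X := X) 6 y (n - 1) k = y (n - 1 - (k : ℤ)) := fun _ => rfl
  have a11 : n - 1 - 1 = n - 2 := by ring
  have a12 : n - 1 - 2 = n - 3 := by ring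
  have a13 : n - 1 - 3 = n - 4 := by ring
  have a14 : n - 1 - 4 = n - 5 := by ring
  have a15 : n - 1 - 5 = n - 6 := by ring
  have a21 : n - 2 - 1 = n - 3 := by ring
  have a22 : n - 2 - 2 = n - 4 := by ring
  have a23 : n - 2 - 3 = n - 5 := by ring
  have a31 : n - 3 - 1 = n - 4 := by ring
  have a32 : n - 3 - 2 = n - 5 := by ring
  have a33 : n - 3 - 3 = n - 6 := by ring
  change _ = _ + ‖∑ i : Fin 7, γ i • y (n - ((i : ℕ) : ℤ))‖ ^ 2
  simp only [weightedNormSq_eq_sum, e1, e2, Fin.sum_univ_succ, bdf3L]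
  simp [a11, a12, a13, a14, a15, a21, a22, a23, a31, a32, a33]
  simp only [← real_inner_self_eq_norm_sq]
  generalize y n = y0 at *
  generalize y (n - 1) = y1 at *
  generalize y (n - 2) = y2 at *
  generalize y (n - 3) = y3 at *
  generalize y (n - 4) = y4 at *
  generalize y (n - 5) = y5 at *
  generalize y (n - 6) = y6 at *
  simp only [inner_add_left, inner_add_right, inner_sub_left, inner_sub_right,
    real_inner_smul_left, real_inner_smul_right]
  -- bring every inner product `⟨y_i, y_j⟩` to one fixed order of its arguments
  simp only [real_inner_comm y0, real_inner_comm y1 y2, real_inner_comm y1 y3,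
    real_inner_comm y1 y4, real_inner_comm y1 y5, real_inner_comm y1 y6, real_inner_comm y2 y3,
    real_inner_comm y2 y4, real_inner_comm y2 y5, real_inner_comm y2 y6, real_inner_comm y3 y4,
    real_inner_comm y3 y5, real_inner_comm y3 y6, real_inner_comm y4 y5, real_inner_comm y4 y6,
    real_inner_comm y5 y6]
  linear_combination -h6 * inner ℝ y0 y6 - h5 * inner ℝ y1 y6 - h4 * inner ℝ y2 y6
    - h3 * inner ℝ y3 y6 - h2 * inner ℝ y4 y6 - h1 * inner ℝ y5 y6 - h0 * inner ℝ y6 y6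

end Energy

/-! ### Spectral factorization of cosine polynomials -/

section SpectralFactor

open Polynomial

/-- `p` is a real spectral factor of degree at most `n` of the cosine polynomial `q(cos θ)`, that
is `p(z) p(1/z) = q((z + 1/z) / 2)`. The last field is the consequence for real `z` of `p` having
exact degree `n` and all its zeros in the closed unit disc; it is recorded instead of the location
of the zeros because it is multiplicative and keeps the top coefficient away from `0`.
The identity is asked for real `z` only, which determines all coefficients. -/
structure IsOuterFactor (n : ℕ) (q p : ℝ[X]) : Prop where
  natDegree_le : p.natDegree ≤ n
  eval_mul_eval_inv : ∀ z : ℝ, z ≠ 0 → p.eval z * p.eval z⁻¹ = q.eval ((z + z⁻¹) / 2)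
  abs_eval_le : ∀ z : ℝ, |p.eval z| ≤ |p.coeff n| * (1 + |z|) ^ n

theorem IsOuterFactor.mul {m n : ℕ} {q r p s : ℝ[X]} (hp : IsOuterFactor m q p)
    (hs : IsOuterFactor n r s) : IsOuterFactor (m + n) (q * r) (p * s) where
  natDegree_le := natDegree_mul_le_of_le hp.natDegree_le hs.natDegree_le
  eval_mul_eval_inv z hz := by
    rw [eval_mul, eval_mul, eval_mul, ← hp.eval_mul_eval_inv z hz, ← hs.eval_mul_eval_inv z hz]
    ring
  abs_eval_le z := by
    rw [coeff_mul_add_eq_of_natDegree_le hp.natDegree_le hs.natDegree_le, eval_mul, abs_mul,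
      abs_mul, pow_add]
    calc |p.eval z| * |s.eval z|
        ≤ (|p.coeff m| * (1 + |z|) ^ m) * (|s.coeff n| * (1 + |z|) ^ n) :=
          mul_le_mul (hp.abs_eval_le z) (hs.abs_eval_le z) (abs_nonneg _) (by positivity)
      _ = _ := by ring

theorem isOuterFactor_C {c : ℝ} (hc : 0 ≤ c) : IsOuterFactor 0 (C c) (C √c) where
  natDegree_le := by simp
  eval_mul_eval_inv z _ := by simp [Real.mul_self_sqrt hc]
  abs_eval_le z := by simp

/-- The factor `X` pads a spectral factor to a larger degree without lowering its top
coefficient. -/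
theorem isOuterFactor_X : IsOuterFactor 1 1 X where
  natDegree_le := by simp
  eval_mul_eval_inv z hz := by simp [hz]
  abs_eval_le z := by simp

theorem exists_isOuterFactor_linear {a b : ℝ} (h : |a| ≤ b) :
    ∃ p, IsOuterFactor 1 (C a * X + C b) p := by
  obtain ⟨h1, h2⟩ := abs_le.1 h
  have hA := Real.sq_sqrt (show 0 ≤ b + a by linarith)
  have hB := Real.sq_sqrt (show 0 ≤ b - a by linarith)
  have hA0 := Real.sqrt_nonneg (b + a)
  have hB0 := Real.sqrt_nonneg (b - a)
  set A := √(b + a)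
  set B := √(b - a)
  -- the factor takes the values `A` at `1` and `B` at `-1`, up to sign; its zero is in `[-1, 1]`
  refine ⟨C ((A + B) / 2) * X + C ((A - B) / 2), natDegree_linear_le, fun z hz => ?_,
    fun z => ?_⟩
  · simp only [eval_add, eval_mul, eval_C, eval_X]
    field_simp
    linear_combination (z + 1) ^ 2 * hA - (z - 1) ^ 2 * hB
  · have hc : (C ((A + B) / 2) * X + C ((A - B) / 2) : ℝ[X]).coeff 1 = (A + B) / 2 := by
      simp
    rw [hc]
    simp only [eval_add, eval_mul, eval_C, eval_X]
    have hd : |(A - B) / 2| ≤ (A + B) / 2 := abs_le.2 ⟨by linarith, by linarith⟩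
    rw [abs_of_nonneg (by positivity : 0 ≤ (A + B) / 2), pow_one]
    calc |(A + B) / 2 * z + (A - B) / 2| ≤ |(A + B) / 2 * z| + |(A - B) / 2| := abs_add_le _ _
      _ ≤ (A + B) / 2 * |z| + (A + B) / 2 := by
          rw [abs_mul, abs_of_nonneg (by positivity : 0 ≤ (A + B) / 2)]; gcongr
      _ = _ := by ring

theorem exists_isOuterFactor_quadratic {a b c : ℝ} (ha : 0 < a) (h : b ^ 2 < 4 * a * c) :
    ∃ p, IsOuterFactor 2 (C a * X ^ 2 + C b * X + C c) p := by
  have hc : 0 < c := by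
    by_contra! hc
    nlinarith [sq_nonneg b]
  have hAp : 0 ≤ a + b + c := by nlinarith [sq_nonneg (2 * a + b)]
  have hBp : 0 ≤ a - b + c := by nlinarith [sq_nonneg (2 * a - b)]
  have hA := Real.sq_sqrt hAp
  have hB := Real.sq_sqrt hBp
  have hA0 := Real.sqrt_nonneg (a + b + c)
  have hB0 := Real.sqrt_nonneg (a - b + c)
  set A := √(a + b + c)
  set B := √(a - b + c)
  -- equivalent to the discriminant of `t ^ 2 - (A + B) / 2 * t + a / 4` being nonnegative
  have hAB : a - c ≤ A * B := by
    refine le_of_abs_le (abs_le_of_sq_le_sq ?_ (by positivity))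
    rw [mul_pow, hA, hB]
    nlinarith
  have hD : 0 ≤ ((A + B) / 2) ^ 2 - a := by nlinarith
  have hS := Real.sq_sqrt hD
  have hS0 := Real.sqrt_nonneg (((A + B) / 2) ^ 2 - a)
  have hle : √(((A + B) / 2) ^ 2 - a) ≤ (A + B) / 2 :=
    Real.sqrt_le_iff.2 ⟨by positivity, by linarith⟩
  set S := √(((A + B) / 2) ^ 2 - a)
  -- the factor `w z ^ 2 + v z + u` takes the values `A` and `B` at `1` and `-1`, so that
  -- `u + w = (A + B) / 2` and `v = (A - B) / 2`; moreover `u w = a / 4`, and `w` is the larger root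
  obtain ⟨w, hw⟩ : ∃ w, w = ((A + B) / 2 + S) / 2 := ⟨_, rfl⟩
  obtain ⟨u, hu⟩ : ∃ u, u = ((A + B) / 2 - S) / 2 := ⟨_, rfl⟩
  obtain ⟨v, hv⟩ : ∃ v, v = (A - B) / 2 := ⟨_, rfl⟩
  have hw0 : 0 ≤ w := by rw [hw]; positivity
  have hu0 : 0 ≤ u := by rw [hu]; linarith
  have huw : u ≤ w := by rw [hu, hw]; linarith
  have hvw : |v| ≤ 2 * w := by rw [hv, hw]; exact abs_le.2 ⟨by linarith, by linarith⟩
  have e1 : 4 * (u * w) = a := by rw [hu, hw]; linear_combination -hS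
  have e2 : 2 * (u + w) * v = b := by rw [hu, hw, hv]; linear_combination (hA - hB) / 2
  have e3 : u ^ 2 + v ^ 2 + w ^ 2 = c + a / 2 := by
    have : (u + w) ^ 2 + v ^ 2 = a + c := by rw [hu, hw, hv]; linear_combination (hA + hB) / 2
    linear_combination this - e1 / 2
  have hcoef : (C w * X ^ 2 + C v * X + C u : ℝ[X]).coeff 2 = w := by
    simp
  refine ⟨C w * X ^ 2 + C v * X + C u, natDegree_quadratic_le, fun z hz => ?_, fun z => ?_⟩
  · simp only [eval_add, eval_mul, eval_C, eval_X, eval_pow]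
    rw [← e1, ← e2, show c = u ^ 2 + v ^ 2 + w ^ 2 - 2 * (u * w) by linear_combination e1 / 2 - e3]
    field_simp
    ring
  · rw [hcoef, abs_of_nonneg hw0]
    simp only [eval_add, eval_mul, eval_C, eval_X, eval_pow]
    calc |w * z ^ 2 + v * z + u| ≤ |w * z ^ 2| + |v * z| + |u| := abs_add_three _ _ _
      _ ≤ w * |z| ^ 2 + 2 * w * |z| + w := by
          rw [abs_mul, abs_mul, abs_pow, abs_of_nonneg hw0, abs_of_nonneg hu0]; gcongr
      _ = _ := by ring

theorem exists_isOuterFactor_of_irreducible {f : ℝ[X]} (hf : Irreducible f)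
    (hpos : ∀ x ∈ Set.Ioo (-1 : ℝ) 1, 0 < f.eval x) : ∃ p, IsOuterFactor f.natDegree f p := by
  have h2 := hf.natDegree_le_two
  have h1 := hf.natDegree_pos
  have hcl : ∀ x ∈ Set.Icc (-1 : ℝ) 1, 0 ≤ f.eval x := by
    intro x hx
    rw [← closure_Ioo (by norm_num)] at hx
    exact le_on_closure (f := fun _ => (0 : ℝ)) (fun y hy => (hpos y hy).le) continuousOn_const
      f.continuous.continuousOn hx
  obtain hd | hd : f.natDegree = 1 ∨ f.natDegree = 2 := by omega
  · obtain ⟨a, b, hab⟩ := exists_eq_X_add_C_of_natDegree_le_one hd.le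
    have e1 := hcl 1 (by norm_num)
    have e2 := hcl (-1) (by norm_num)
    rw [hd, hab]
    rw [hab] at e1 e2
    simp only [eval_add, eval_mul, eval_C, eval_X] at e1 e2
    exact exists_isOuterFactor_linear (abs_le.2 ⟨by linarith, by linarith⟩)
  · have hab := eq_quadratic_of_degree_le_two (natDegree_le_iff_degree_le.1 hd.le)
    have hne : f.coeff 2 ≠ 0 := by
      rw [← hd]; exact leadingCoeff_ne_zero.2 hf.ne_zero
    have hroot : ∀ x, f.eval x ≠ 0 := fun x hx => by
      have h := natDegree_eq_of_degree_eq_some (degree_eq_one_of_irreducible_of_root hf hx)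
      rw [hd] at h
      exact absurd h (by norm_num)
    have hall : ∀ x, 0 < f.eval x := by
      intro x
      by_contra! hx
      obtain ⟨y, hy⟩ := mem_range_of_exists_le_of_exists_ge f.continuous ⟨x, hx⟩
        ⟨0, (hpos 0 (by norm_num)).le⟩
      exact hroot y hy
    have hev : ∀ x, f.eval x = f.coeff 2 * (x * x) + f.coeff 1 * x + f.coeff 0 := fun x => by
      conv_lhs => rw [hab]
      simp only [eval_add, eval_mul, eval_C, eval_X, eval_pow]
      ring
    have hdis := discrim_lt_zero hne fun x => hev x ▸ hall x
    rw [discrim] at hdis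
    have h0 := hall 0
    rw [hev] at h0
    rw [hd, hab]
    refine exists_isOuterFactor_quadratic ?_ (by linarith)
    by_contra! h
    nlinarith [sq_nonneg (f.coeff 1)]

/-- Fejér–Riesz theorem for real cosine polynomials that are positive on `0 < θ < π`; the factor
can be chosen with its zeros in the closed unit disc. Irreducible real factors have degree at most
two, and up to sign each is positive on the open interval. -/
theorem exists_isOuterFactor (n : ℕ) : ∀ q : ℝ[X], q.natDegree ≤ n →
    (∀ x ∈ Set.Ioo (-1 : ℝ) 1, 0 < q.eval x) → ∃ p, IsOuterFactor n q p := by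
  induction n using Nat.strong_induction_on with
  | _ n ih =>
    intro q hq hpos
    have hq0 : q ≠ 0 := by
      rintro rfl
      simpa using hpos 0 (by norm_num)
    by_cases hd : q.natDegree = 0
    · obtain ⟨c, rfl⟩ := natDegree_eq_zero.1 hd
      have hc : 0 < c := by simpa using hpos 0 (by norm_num)
      have hX : ∀ k, IsOuterFactor k 1 (X ^ k) := fun k => by
        induction k with
        | zero => simpa using isOuterFactor_C (zero_le_one' ℝ)
        | succ k ih => simpa [pow_succ] using ih.mul isOuterFactor_X
      exact ⟨_, by simpa using (isOuterFactor_C hc.le).mul (hX n)⟩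
    obtain ⟨f, hf, g, hfg⟩ := WfDvdMonoid.exists_irreducible_factor
      (fun hu => hd (natDegree_eq_zero_of_isUnit hu)) hq0
    -- `f` has no zero in the interval, hence constant sign there; replace `f, g` by `-f, -g` if
    -- that sign is negative
    obtain ⟨f, g, hf, hfg, hfpos⟩ : ∃ f g : ℝ[X], Irreducible f ∧ q = f * g ∧
        ∀ x ∈ Set.Ioo (-1 : ℝ) 1, 0 < f.eval x := by
      have hne : ∀ x ∈ Set.Ioo (-1 : ℝ) 1, f.eval x ≠ 0 := fun x hx h0 => by
        have := hpos x hx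
        simp [hfg, h0] at this
      by_cases h0 : 0 < f.eval 0
      · refine ⟨f, g, hf, hfg, fun x hx => ?_⟩
        by_contra! h
        obtain ⟨y, hy, hy0⟩ := isPreconnected_Ioo.intermediate_value hx
          (show (0 : ℝ) ∈ Set.Ioo (-1) 1 by norm_num) f.continuous.continuousOn ⟨h, h0.le⟩
        exact hne y hy hy0
      · refine ⟨-f, -g, (Associated.neg_left (Associated.refl f)).symm.irreducible hf,
          by rw [hfg]; ring, fun x hx => ?_⟩
        by_contra! h
        rw [eval_neg] at h
        obtain ⟨y, hy, hy0⟩ := isPreconnected_Ioo.intermediate_value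
          (show (0 : ℝ) ∈ Set.Ioo (-1) 1 by norm_num) hx f.continuous.continuousOn
          ⟨not_lt.1 h0, by linarith⟩
        exact hne y hy hy0
    have hg0 : g ≠ 0 := by rintro rfl; simp [hq0] at hfg
    have hdeg : q.natDegree = f.natDegree + g.natDegree := by
      rw [hfg, natDegree_mul hf.ne_zero hg0]
    have hfd := hf.natDegree_pos
    obtain ⟨s, hs⟩ := exists_isOuterFactor_of_irreducible hf hfpos
    obtain ⟨r, hr⟩ := ih (n - f.natDegree) (by omega) g (by omega) fun x hx => by
      have := hpos x hx
      rw [hfg, eval_mul] at this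
      exact (pos_iff_pos_of_mul_pos this).1 (hfpos x hx)
    refine ⟨s * r, ?_⟩
    have := hs.mul hr
    rwa [← hfg, show f.natDegree + (n - f.natDegree) = n by omega] at this

end SpectralFactor

/-! ### The symbol for `η = 1/2` and solvability of the system -/

section Symbol

open Polynomial

/-- The polynomial `q` for which `q(cos θ)` is the real part of
`α(z) (1 + μ d(z)) (1 - z⁻¹ / 2)` at `z = exp(iθ)`, where `α` is the BDF-3 polynomial and
`d(z) = 1 - (1 - z) ^ 3`. This is the symbol of the left-hand side of the summation identity for
`η = 1/2`, written so that positivity for `0 ≤ μ ≤ 1/7` is visible: at `μ = 1/7` it acquires the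
zero `x = -1` in addition to `x = 1`. -/
noncomputable def bdf3Symbol (μ : ℝ) : ℝ[X] :=
  (1 - X) * (C (1 - 7 * μ) * (C (4 / 3) * X ^ 2 - C 2 * X + C (5 / 3)) + C (μ / 3) * (1 + X) *
    (C 32 * X ^ 4 - C 128 * X ^ 3 + C 218 * X ^ 2 - C 175 * X + C 65))

theorem eval_bdf3Symbol (μ x : ℝ) : (bdf3Symbol μ).eval x =
    (1 - x) * ((1 - 7 * μ) * (4 / 3 * x ^ 2 - 2 * x + 5 / 3) + μ / 3 * (1 + x) *
      (32 * x ^ 4 - 128 * x ^ 3 + 218 * x ^ 2 - 175 * x + 65)) := by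
  simp only [bdf3Symbol, eval_mul, eval_add, eval_sub, eval_pow, eval_X, eval_C, eval_one]

theorem natDegree_bdf3Symbol_le (μ : ℝ) : (bdf3Symbol μ).natDegree ≤ 6 := by
  unfold bdf3Symbol
  compute_degree

theorem eval_bdf3Symbol_pos {μ x : ℝ} (h0 : 0 ≤ μ) (h1 : μ ≤ 1 / 7) (hx : x ∈ Set.Ioo (-1 : ℝ) 1) :
    0 < (bdf3Symbol μ).eval x := by
  obtain ⟨hx1, hx2⟩ := hx
  rw [eval_bdf3Symbol]
  have ha : 0 < 4 / 3 * x ^ 2 - 2 * x + 5 / 3 := by nlinarith [sq_nonneg (x - 3 / 4)]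
  have hb : 0 < 32 * x ^ 4 - 128 * x ^ 3 + 218 * x ^ 2 - 175 * x + 65 := by
    have h : 0 < 58 * x ^ 2 - 111 * x + 57 := by nlinarith [sq_nonneg (x - 111 / 116)]
    nlinarith [sq_nonneg (x ^ 2 - 2 * x + 1 / 2)]
  refine mul_pos (by linarith) ?_
  obtain rfl | hμ := h0.eq_or_lt
  · linarith
  · have : 0 ≤ (1 - 7 * μ) * (4 / 3 * x ^ 2 - 2 * x + 5 / 3) := mul_nonneg (by linarith) ha.le
    have : 0 < μ / 3 * (1 + x) * (32 * x ^ 4 - 128 * x ^ 3 + 218 * x ^ 2 - 175 * x + 65) :=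
      mul_pos (mul_pos (by linarith) (by linarith)) hb
    linarith

theorem coeff_eq_zero_of_forall_sum_eq_zero {n : ℕ} (c : Fin n → ℝ)
    (h : ∀ z : ℝ, z ≠ 0 → ∑ i, c i * z ^ (i : ℕ) = 0) (i : Fin n) : c i = 0 := by
  have hP : ∑ j, C (c j) * X ^ (j : ℕ) = (0 : ℝ[X]) := by
    refine eq_zero_of_infinite_isRoot _ ((Set.finite_singleton (0 : ℝ)).infinite_compl.mono ?_)
    intro z hz
    simpa [IsRoot, eval_finsetSum] using h z hz
  have := congrArg (fun p => p.coeff (i : ℕ)) hP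
  simpa [finsetSum_coeff, coeff_C_mul, coeff_X_pow, Fin.val_inj] using this

/-- The system for `η = 1/2` compares the coefficients of
`Γ(z) Γ(1/z) = q((z + 1/z) / 2)`. -/
theorem BDF3System.of_factorization {μ : ℝ} {γ : Fin 7 → ℝ}
    (h : ∀ z : ℝ, z ≠ 0 → (∑ i, γ i * z ^ (i : ℕ)) * (∑ i, γ i * z⁻¹ ^ (i : ℕ)) =
      (bdf3Symbol μ).eval ((z + z⁻¹) / 2)) : BDF3System μ (1 / 2) γ := by
  obtain ⟨e6, h6⟩ : ∃ e, e = 2 * γ 0 * γ 6 + 1 / 3 * μ := ⟨_, rfl⟩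
  obtain ⟨e5, h5⟩ : ∃ e, e = 2 * γ 0 * γ 5 + 2 * γ 1 * γ 6 - (1 / 6 * μ + 5 / 2 * μ) := ⟨_, rfl⟩
  obtain ⟨e4, h4⟩ : ∃ e, e = 2 * γ 0 * γ 4 + 2 * γ 1 * γ 5 + 2 * γ 2 * γ 6
    - (-(5 / 4) * μ - 17 / 2 * μ) := ⟨_, rfl⟩
  obtain ⟨e3, h3⟩ : ∃ e, e = 2 * γ 0 * γ 3 + 2 * γ 1 * γ 4 + 2 * γ 2 * γ 5 + 2 * γ 3 * γ 6
    - (17 / 4 * μ + 46 / 3 * μ - 1 / 3) := ⟨_, rfl⟩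
  obtain ⟨e2, h2⟩ : ∃ e, e = 2 * γ 0 * γ 2 + 2 * γ 1 * γ 3 + 2 * γ 2 * γ 4 + 2 * γ 3 * γ 5
    + 2 * γ 4 * γ 6 - (-(46 / 6) * μ + 1 / 6 - 29 / 2 * μ + 3 / 2) := ⟨_, rfl⟩
  obtain ⟨e1, h1⟩ : ∃ e, e = 2 * γ 0 * γ 1 + 2 * γ 1 * γ 2 + 2 * γ 2 * γ 3 + 2 * γ 3 * γ 4
    + 2 * γ 4 * γ 5 + 2 * γ 5 * γ 6 - (29 / 4 * μ - 10 / 6 + 11 / 2 * μ - 3) := ⟨_, rfl⟩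
  obtain ⟨e0, h0⟩ : ∃ e, e = γ 0 ^ 2 + γ 1 ^ 2 + γ 2 ^ 2 + γ 3 ^ 2 + γ 4 ^ 2 + γ 5 ^ 2 + γ 6 ^ 2
    - (-(11 / 4) * μ + 3 / 2 + 11 / 6) := ⟨_, rfl⟩
  -- `e_k` are the defects of the equations; `2 z ^ 6 (Γ(z) Γ(1/z) - q)` has these coefficients
  have hc := coeff_eq_zero_of_forall_sum_eq_zero
    ![e6, e5, e4, e3, e2, e1, 2 * e0, e1, e2, e3, e4, e5, e6] fun z hz => by
      have hz' := h z hz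
      rw [eval_bdf3Symbol] at hz'
      simp [Fin.sum_univ_succ] at hz' ⊢
      field_simp at hz'
      rw [h0, h1, h2, h3, h4, h5, h6]
      linear_combination hz' / 96
  have hc6 := hc 0
  have hc5 := hc 1
  have hc4 := hc 2
  have hc3 := hc 3
  have hc2 := hc 4
  have hc1 := hc 5
  have hc0 := hc 6
  simp at hc6 hc5 hc4 hc3 hc2 hc1 hc0
  refine ⟨?_, ?_, ?_, ?_, ?_, ?_, ?_⟩ <;> linarith

/-- Solvability with a lower bound for `γ_6` that is uniform in `μ`. The bound excludes the
spectral factors whose `γ_6` vanishes at `μ = 0` or tends to `0` as `μ → 0`. -/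
theorem exists_bdf3System {μ : ℝ} (h0 : 0 ≤ μ) (h1 : μ ≤ 1 / 7) :
    ∃ γ : Fin 7 → ℝ, BDF3System μ (1 / 2) γ ∧ 1 / 30000 ≤ γ 6 ^ 2 := by
  obtain ⟨p, hp⟩ := exists_isOuterFactor 6 (bdf3Symbol μ) (natDegree_bdf3Symbol_le μ)
    fun x hx => eval_bdf3Symbol_pos h0 h1 hx
  refine ⟨fun i => p.coeff i, BDF3System.of_factorization fun z hz => ?_, ?_⟩
  · rw [← hp.eval_mul_eval_inv z hz]
    simp only [eval_eq_sum_range' (Nat.lt_succ_of_le hp.natDegree_le), ← Fin.sum_univ_eq_sum_range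
      (fun i => p.coeff i * _ ^ i)]
  · -- `|Γ(2)| ≤ 3 ^ 6 |γ_6|` and `|Γ(1/2)| ≤ (3/2) ^ 6 |γ_6|`, while
    -- `|Γ(2) Γ(1/2)| = |q(5/4)| ≥ 5/16`
    have e := hp.eval_mul_eval_inv 2 two_ne_zero
    have b1 := hp.abs_eval_le 2
    have b2 := hp.abs_eval_le 2⁻¹
    rw [eval_bdf3Symbol] at e
    change 1 / 30000 ≤ p.coeff 6 ^ 2
    rw [← sq_abs]
    have hm := mul_le_mul b1 b2 (abs_nonneg _) (by positivity)
    rw [← abs_mul, e] at hm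
    have hl := neg_le_of_abs_le hm
    norm_num [abs_of_pos] at hl
    nlinarith

end Symbol

/-! ### The quadratic form of `G` as a sum of squares -/

/-- The sequence with `y^{-i} = v_i` for `0 ≤ i ≤ 5` and `y^m = y^{m-1} / 2` for `m ≥ 1`. The
values for `m < -5` are irrelevant (the index wraps around modulo `6`). -/
noncomputable def halvingExtension (v : Fin 6 → ℝ) (m : ℤ) : ℝ :=
  if m ≤ 0 then v (Fin.ofNat 6 (-m).toNat) else v 0 / 2 ^ m.toNat

/-- The linear form `∑ γ_i y^{n-i}` along the sequence `halvingExtension v`. -/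
noncomputable def extResidual (γ : Fin 7 → ℝ) (v : Fin 6 → ℝ) (n : ℤ) : ℝ :=
  ∑ i, γ i * halvingExtension v (n - (i : ℤ))

theorem stacked_halvingExtension (v : Fin 6 → ℝ) : stacked 6 (halvingExtension v) 0 = v := by
  ext i
  fin_cases i <;> rfl

theorem halvingExtension_succ (v : Fin 6 → ℝ) {n : ℤ} (hn : 1 ≤ n) :
    halvingExtension v n = 1 / 2 * halvingExtension v (n - 1) := by
  obtain ⟨m, rfl⟩ : ∃ m : ℕ, n = m + 1 := ⟨(n - 1).toNat, by omega⟩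
  have h1 : ¬ ((m : ℤ) + 1 ≤ 0) := by omega
  rcases m with _ | m
  · simp [halvingExtension]; ring_nf
  · have h2 : ¬ ((m : ℤ) + 1 ≤ 0) := by omega
    have e : ((m : ℤ) + 1 + 1).toNat = m + 2 := by omega
    have e' : ((m : ℤ) + 1).toNat = m + 1 := by omega
    push_cast at h1 ⊢
    simp only [halvingExtension, h1, h2, if_false, add_sub_cancel_right, e, e']
    field_simp
    ring

/-- Along the halving sequence the left-hand side of the summation identity for `η = 1/2`
vanishes, so `‖Y^{n-1}‖_G² = ‖Y^n‖_G² + r_n²`. From `Y^5` on the sequence is geometric,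
`‖Y^6‖_G² = ‖Y^5‖_G² / 4`, which closes the recursion with the factor `4/3`. -/
theorem BDF3System.weightedNormSq_eq {μ : ℝ} {γ : Fin 7 → ℝ} (h : BDF3System μ (1 / 2) γ)
    (v : Fin 6 → ℝ) : weightedNormSq (bdf3G μ (1 / 2) γ) v =
      extResidual γ v 1 ^ 2 + extResidual γ v 2 ^ 2 + extResidual γ v 3 ^ 2 + extResidual γ v 4 ^ 2 +
        extResidual γ v 5 ^ 2 + 4 / 3 * extResidual γ v 6 ^ 2 := by
  have key : ∀ n : ℤ, 1 ≤ n →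
      weightedNormSq (bdf3G μ (1 / 2) γ) (stacked 6 (halvingExtension v) (n - 1)) =
        weightedNormSq (bdf3G μ (1 / 2) γ) (stacked 6 (halvingExtension v) n) +
          extResidual γ v n ^ 2 := by
    intro n hn
    have e := h.energy_identity (X := ℝ) one_ne_zero (halvingExtension v) n
    rw [halvingExtension_succ v hn, smul_eq_mul (1 / 2 : ℝ), sub_self, inner_zero_right, Real.norm_eq_abs,
      sq_abs] at e
    change 0 = weightedNormSq (bdf3G μ (1 / 2) γ) (stacked 6 (halvingExtension v) n) -
      weightedNormSq (bdf3G μ (1 / 2) γ) (stacked 6 (halvingExtension v) (n - 1)) +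
      extResidual γ v n ^ 2 at e
    linarith
  have h6 : stacked 6 (halvingExtension v) 6 =
      (1 / 2 : ℝ) • stacked 6 (halvingExtension v) 5 := by
    ext i
    have hi := i.2
    simp only [stacked, Pi.smul_apply, smul_eq_mul]
    rw [halvingExtension_succ v (by omega)]
    congr 2
    ring
  have k1 := key 1 (by norm_num)
  have k2 := key 2 (by norm_num)
  have k3 := key 3 (by norm_num)
  have k4 := key 4 (by norm_num)
  have k5 := key 5 (by norm_num)
  have k6 := key 6 (by norm_num)
  norm_num only at k1 k2 k3 k4 k5 k6
  rw [stacked_halvingExtension] at k1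
  rw [h6, weightedNormSq_smul] at k6
  norm_num only at k1 k2 k3 k4 k5 k6
  linarith

/-- The sixth residual is `v_0 Γ(2) / 64`, and `Γ(2) Γ(1/2) = q(5/4) ≠ 0`; once `v_0 = 0`, the
others determine `v_1, …, v_5` in turn through the coefficient `γ_6`. -/
theorem BDF3System.eq_zero_of_residual_eq_zero {μ : ℝ} {γ : Fin 7 → ℝ}
    (h : BDF3System μ (1 / 2) γ) (hμ : 0 ≤ μ) (h6 : γ 6 ≠ 0) {v : Fin 6 → ℝ}
    (hv : ∀ n ∈ Finset.Icc (1 : ℤ) 6, extResidual γ v n = 0) : v = 0 := by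
  have hΓ : γ 0 + γ 1 * 2 + γ 2 * 4 + γ 3 * 8 + γ 4 * 16 + γ 5 * 32 + γ 6 * 64 ≠ 0 := by
    intro hz
    obtain ⟨g6, g5, g4, g3, g2, g1, g0⟩ := h
    -- weights `(2 ^ k + 2 ^ (-k)) / 2`, as for the evaluation of `Γ(z) Γ(1/z)` at `z = 2`
    have : (γ 0 + γ 1 * 2 + γ 2 * 4 + γ 3 * 8 + γ 4 * 16 + γ 5 * 32 + γ 6 * 64) *
        (γ 0 + γ 1 / 2 + γ 2 / 4 + γ 3 / 8 + γ 4 / 16 + γ 5 / 32 + γ 6 / 64) =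
        -(5 / 16 + 5 / 8 * μ) := by
      linear_combination g0 + (2 + 1 / 2) / 2 * g1 + (4 + 1 / 4) / 2 * g2 + (8 + 1 / 8) / 2 * g3
        + (16 + 1 / 16) / 2 * g4 + (32 + 1 / 32) / 2 * g5 + (64 + 1 / 64) / 2 * g6
    rw [hz, zero_mul] at this
    linarith
  have r1 := hv 1 (by decide)
  have r2 := hv 2 (by decide)
  have r3 := hv 3 (by decide)
  have r4 := hv 4 (by decide)
  have r5 := hv 5 (by decide)
  have r6 := hv 6 (by decide)
  have y1 : halvingExtension v 1 = v 0 / 2 := by simp [halvingExtension]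
  have y2 : halvingExtension v 2 = v 0 / 4 := by
    rw [halvingExtension_succ v (by norm_num)]; norm_num [y1]; ring
  have y3 : halvingExtension v 3 = v 0 / 8 := by
    rw [halvingExtension_succ v (by norm_num)]; norm_num [y2]; ring
  have y4 : halvingExtension v 4 = v 0 / 16 := by
    rw [halvingExtension_succ v (by norm_num)]; norm_num [y3]; ring
  have y5 : halvingExtension v 5 = v 0 / 32 := by
    rw [halvingExtension_succ v (by norm_num)]; norm_num [y4]; ring
  have y6 : halvingExtension v 6 = v 0 / 64 := by
    rw [halvingExtension_succ v (by norm_num)]; norm_num [y5]; ring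
  have x0 : halvingExtension v 0 = v 0 := rfl
  have x1 : halvingExtension v (-1) = v 1 := rfl
  have x2 : halvingExtension v (-2) = v 2 := rfl
  have x3 : halvingExtension v (-3) = v 3 := rfl
  have x4 : halvingExtension v (-4) = v 4 := rfl
  have x5 : halvingExtension v (-5) = v 5 := rfl
  simp [extResidual, Fin.sum_univ_succ, y1, y2, y3, y4, y5, y6, x0, x1, x2, x3, x4, x5]
    at r1 r2 r3 r4 r5 r6
  have v0 : v 0 = 0 := by
    refine (mul_eq_zero.1 ?_).resolve_left hΓ
    linear_combination 64 * r6
  have v1 : v 1 = 0 := by simpa [v0, h6] using r5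
  have v2 : v 2 = 0 := by simpa [v0, v1, h6] using r4
  have v3 : v 3 = 0 := by simpa [v0, v1, v2, h6] using r3
  have v4 : v 4 = 0 := by simpa [v0, v1, v2, v3, h6] using r2
  have v5 : v 5 = 0 := by simpa [v0, v1, v2, v3, v4, h6] using r1
  ext i
  fin_cases i <;> assumption

/-! ### Uniform bounds for `G` and its eigenvalues -/

theorem isHermitian_bdf3G (μ η : ℝ) (γ : Fin 7 → ℝ) : (bdf3G μ η γ).IsHermitian := by
  unfold bdf3G
  refine Matrix.IsHermitian.sub (Matrix.IsHermitian.add (Matrix.IsHermitian.add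
    (Matrix.IsHermitian.add ?_ ?_) ?_) ?_) ?_
  · ext i j; fin_cases i <;> fin_cases j <;> rfl
  · refine Matrix.IsHermitian.smul ?_ (.all _)
    ext i j; fin_cases i <;> fin_cases j <;> rfl
  · refine Matrix.IsHermitian.smul ?_ (.all _)
    ext i j; fin_cases i <;> fin_cases j <;> rfl
  · refine Matrix.IsHermitian.smul ?_ (.all _)
    ext i j; fin_cases i <;> fin_cases j <;> rfl
  · simpa using Matrix.isHermitian_mul_conjTranspose_self (bdf3L γ)

theorem dotProduct_mulVec_eq_weightedNormSq {s : ℕ} (G : Matrix (Fin s) (Fin s) ℝ)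
    (v : Fin s → ℝ) : v ⬝ᵥ G.mulVec v = weightedNormSq G v := by
  simp only [dotProduct, Matrix.mulVec, weightedNormSq]
  simp

theorem BDF3System.abs_le_two {μ : ℝ} {γ : Fin 7 → ℝ} (h : BDF3System μ (1 / 2) γ)
    (hμ : 0 ≤ μ) (i : Fin 7) : |γ i| ≤ 2 := by
  obtain ⟨-, -, -, -, -, -, h0⟩ := h
  refine abs_le_of_sq_le_sq ?_ (by norm_num)
  have : γ i ^ 2 ≤ ∑ j, γ j ^ 2 :=
    Finset.single_le_sum (f := fun j => γ j ^ 2) (fun j _ => sq_nonneg _) (Finset.mem_univ i)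
  rw [Fin.sum_univ_seven] at this
  linarith

theorem continuous_halvingExtension (m : ℤ) : Continuous fun v => halvingExtension v m := by
  unfold halvingExtension
  split_ifs <;> fun_prop

theorem isClosed_setOf_bdf3System (η : ℝ) :
    IsClosed {p : ℝ × (Fin 7 → ℝ) | BDF3System p.1 η p.2} := by
  unfold BDF3System
  refine IsClosed.and ?_ <| IsClosed.and ?_ <| IsClosed.and ?_ <| IsClosed.and ?_ <|
    IsClosed.and ?_ <| IsClosed.and ?_ ?_
  all_goals exact isClosed_eq (by fun_prop) (by fun_prop)

/-- The pairs of `μ ∈ [0, 1/7]` and solutions `γ` with `γ_6 ^ 2 ≥ 1/30000` form a compact set, and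
on it the quadratic form of `G` is positive at every unit vector. -/
theorem exists_uniform_bounds : ∃ c C : ℝ, 0 < c ∧ ∀ μ ∈ Set.Icc (0 : ℝ) (1 / 7),
    ∀ γ : Fin 7 → ℝ, BDF3System μ (1 / 2) γ → 1 / 30000 ≤ γ 6 ^ 2 → ∀ v : Fin 6 → ℝ,
      c * (v ⬝ᵥ v) ≤ weightedNormSq (bdf3G μ (1 / 2) γ) v ∧
      weightedNormSq (bdf3G μ (1 / 2) γ) v ≤ C * (v ⬝ᵥ v) := by
  set K : Set ((ℝ × (Fin 7 → ℝ)) × (Fin 6 → ℝ)) :=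
    {p | p.1.1 ∈ Set.Icc (0 : ℝ) (1 / 7) ∧ BDF3System p.1.1 (1 / 2) p.1.2 ∧
      1 / 30000 ≤ p.1.2 6 ^ 2 ∧ p.2 ⬝ᵥ p.2 = 1} with hKdef
  have hK : IsCompact K := by
    refine IsCompact.of_isClosed_subset
      ((isCompact_Icc (a := (0 : ℝ)) (b := 1 / 7)).prod
        (isCompact_univ_pi fun _ : Fin 7 => isCompact_Icc (a := (-2 : ℝ)) (b := 2)) |>.prod
        (isCompact_univ_pi fun _ : Fin 6 => isCompact_Icc (a := (-1 : ℝ)) (b := 1))) ?_ ?_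
    · refine IsClosed.and ?_ <| IsClosed.and ?_ <| IsClosed.and ?_ ?_
      · exact isClosed_Icc.preimage (by fun_prop)
      · exact (isClosed_setOf_bdf3System (1 / 2)).preimage continuous_fst
      · exact isClosed_le (by fun_prop) (by fun_prop)
      · simp only [dotProduct]
        exact isClosed_eq (by fun_prop) (by fun_prop)
    · rintro ⟨⟨μ, γ⟩, v⟩ ⟨h1, h2, h3, h4⟩
      refine ⟨⟨h1, fun i _ => abs_le.1 (h2.abs_le_two h1.1 i)⟩, fun i _ => abs_le.1 ?_⟩
      refine abs_le_of_sq_le_sq ?_ zero_le_one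
      rw [one_pow, ← h4, dotProduct, sq]
      exact Finset.single_le_sum (f := fun j => v j * v j) (fun j _ => mul_self_nonneg _)
        (Finset.mem_univ i)
  have hne : K.Nonempty := by
    obtain ⟨γ, hγ, h6⟩ := exists_bdf3System le_rfl (by norm_num)
    exact ⟨((0, γ), Pi.single 0 1), by norm_num, hγ, h6, by simp⟩
  set f : (ℝ × (Fin 7 → ℝ)) × (Fin 6 → ℝ) → ℝ := fun p =>
    extResidual p.1.2 p.2 1 ^ 2 + extResidual p.1.2 p.2 2 ^ 2 + extResidual p.1.2 p.2 3 ^ 2 +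
      extResidual p.1.2 p.2 4 ^ 2 + extResidual p.1.2 p.2 5 ^ 2 +
      4 / 3 * extResidual p.1.2 p.2 6 ^ 2 with hf
  have hfc : Continuous f := by
    have hr : ∀ n, Continuous fun p : (ℝ × (Fin 7 → ℝ)) × (Fin 6 → ℝ) =>
        extResidual p.1.2 p.2 n := fun n => by
      unfold extResidual
      refine continuous_finsetSum _ fun i _ => Continuous.mul (by fun_prop) ?_
      exact (continuous_halvingExtension _).comp continuous_snd
    fun_prop
  obtain ⟨p, hp, hmin⟩ := hK.exists_isMinOn hne hfc.continuousOn
  obtain ⟨q, hq, hmax⟩ := hK.exists_isMaxOn hne hfc.continuousOn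
  have hpos : 0 < f p := by
    have hnn : 0 ≤ f p := by positivity
    refine hnn.lt_of_ne' fun h0 => ?_
    obtain ⟨h1, h2, h3, h4⟩ := hp
    have h6 : p.1.2 6 ≠ 0 := fun h => by norm_num [h] at h3
    have hz : p.2 = 0 := by
      refine h2.eq_zero_of_residual_eq_zero h1.1 h6 fun n hn => ?_
      simp only [hf] at h0
      rw [Finset.mem_Icc] at hn
      obtain ⟨hn1, hn2⟩ := hn
      refine pow_eq_zero_iff two_ne_zero |>.1 ?_
      interval_cases n <;> refine le_antisymm ?_ (sq_nonneg _) <;>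
      linarith [sq_nonneg (extResidual p.1.2 p.2 1), sq_nonneg (extResidual p.1.2 p.2 2),
        sq_nonneg (extResidual p.1.2 p.2 3), sq_nonneg (extResidual p.1.2 p.2 4),
        sq_nonneg (extResidual p.1.2 p.2 5), sq_nonneg (extResidual p.1.2 p.2 6)]
    simp [hz] at h4
  refine ⟨f p, f q, hpos, fun μ hμ γ hγ h6 v => ?_⟩
  obtain rfl | hv := eq_or_ne v 0
  · simp [weightedNormSq_eq_sum]
  have hvv : 0 < v ⬝ᵥ v :=
    (dotProduct_self_star_nonneg v).lt_of_ne' fun h => hv (dotProduct_self_eq_zero.1 h)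
  have hs := Real.sq_sqrt hvv.le
  have hs0 := Real.sqrt_pos.2 hvv
  set s := √(v ⬝ᵥ v)
  have hmem : ((μ, γ), s⁻¹ • v) ∈ K := by
    refine ⟨hμ, hγ, h6, ?_⟩
    simp only [smul_dotProduct, dotProduct_smul, smul_eq_mul]
    rw [← hs]
    field_simp
  have hval : weightedNormSq (bdf3G μ (1 / 2) γ) v = f ((μ, γ), s⁻¹ • v) * (v ⬝ᵥ v) := by
    rw [hf]
    simp only
    rw [← hγ.weightedNormSq_eq, weightedNormSq_smul, ← hs]
    field_simp
  rw [hval]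
  exact ⟨mul_le_mul_of_nonneg_right (hmin hmem) hvv.le,
    mul_le_mul_of_nonneg_right (hmax hmem) hvv.le⟩

theorem posDef_of_le_weightedNormSq {s : ℕ} {G : Matrix (Fin s) (Fin s) ℝ} (hG : G.IsHermitian)
    {c : ℝ} (hc : 0 < c) (h : ∀ v, c * (v ⬝ᵥ v) ≤ weightedNormSq G v) : G.PosDef := by
  refine .of_dotProduct_mulVec_pos hG fun v hv => ?_
  have hvv : 0 < v ⬝ᵥ v :=
    (dotProduct_self_star_nonneg v).lt_of_ne' fun h => hv (dotProduct_self_eq_zero.1 h)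
  rw [star_trivial, dotProduct_mulVec_eq_weightedNormSq]
  exact (mul_pos hc hvv).trans_le (h v)

theorem uniformEigenvalueBounds_of_forall {s : ℕ} [NeZero s] {ω c C : ℝ} (hω : 0 ≤ ω) (hc : 0 < c)
    {G : ℝ → Matrix (Fin s) (Fin s) ℝ} (hG : ∀ μ ∈ Set.Icc 0 ω, (G μ).IsHermitian)
    (h : ∀ μ ∈ Set.Icc 0 ω, ∀ v, c * (v ⬝ᵥ v) ≤ weightedNormSq (G μ) v ∧
      weightedNormSq (G μ) v ≤ C * (v ⬝ᵥ v)) : UniformEigenvalueBounds ω G := by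
  have key : ∀ l ∈ eigenvalueSet ω G, c ≤ l ∧ l ≤ C := by
    rintro l ⟨μ, hμ, hl⟩
    obtain ⟨v, hv⟩ := hl.exists_hasEigenvector
    have hvv : 0 < v ⬝ᵥ v :=
      (dotProduct_self_star_nonneg v).lt_of_ne' fun h => hv.2 (dotProduct_self_eq_zero.1 h)
    have e := hv.apply_eq_smul
    rw [Matrix.toLin'_apply] at e
    obtain ⟨h1, h2⟩ := h μ hμ v
    rw [← dotProduct_mulVec_eq_weightedNormSq, e, dotProduct_smul, smul_eq_mul] at h1 h2
    exact ⟨le_of_mul_le_mul_right h1 hvv, le_of_mul_le_mul_right h2 hvv⟩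
  have hne : (eigenvalueSet ω G).Nonempty := by
    have h0 : (0 : ℝ) ∈ Set.Icc 0 ω := ⟨le_rfl, hω⟩
    have hH := hG 0 h0
    refine ⟨hH.eigenvalues 0, 0, h0, ?_⟩
    refine Module.End.hasEigenvalue_of_hasEigenvector (x := (hH.eigenvectorBasis 0).ofLp)
      ⟨Module.End.mem_eigenspace_iff.2 ?_, fun hz => ?_⟩
    · rw [Matrix.toLin'_apply, hH.mulVec_eigenvectorBasis]
    · exact hH.eigenvectorBasis.toBasis.ne_zero 0 (by
        simpa using (WithLp.ofLp_eq_zero 2).1 hz)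
  exact ⟨hc.trans_le (le_csInf hne fun l hl => (key l hl).1), C, fun l hl => (key l hl).2⟩

theorem mainTheorem5 :
    -- every real solution of the system satisfies the identity for the odd coefficients
    (∀ (μ η : ℝ) (γ : Fin 7 → ℝ), BDF3System μ η γ →
      (γ 1 + γ 3 + γ 5) ^ 2 = 5 / 3 * (1 + η) * (1 - 7 * μ)) ∧
    -- no real solution for `μ > 1/7`
    (∀ μ η : ℝ, 0 ≤ η → 1 / 7 < μ → ¬ ∃ γ : Fin 7 → ℝ, BDF3System μ η γ) ∧
    -- solvability with positive definite `G` for `μ ≤ 1/7`, with one multiplier for all `μ`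
    (∃ η : ℝ, 0 ≤ η ∧ η < 1 ∧ ∀ μ : ℝ, 0 ≤ μ → μ ≤ 1 / 7 →
      ∃ γ : Fin 7 → ℝ, BDF3System μ η γ ∧ (bdf3G μ η γ).PosDef) ∧
    -- both assumptions hold for `k = δ = 3` and `ω ≤ 1/7`
    (∀ (X : Type*) [NormedAddCommGroup X] [InnerProductSpace ℝ X] [CompleteSpace X]
      (ω τ : ℝ), 0 < ω → ω ≤ 1 / 7 → 0 < τ →
      ∃ (η : ℝ) (G : ℝ → Matrix (Fin (3 + 3)) (Fin (3 + 3)) ℝ) (γ : ℝ → Fin (3 + 3 + 1) → ℝ),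
        SummationAssumption X 3 3 ω τ η G γ ∧ UniformEigenvalueBounds ω G) := by
  obtain ⟨c, C, hc, hbound⟩ := exists_uniform_bounds
  have hpd : ∀ μ ∈ Set.Icc (0 : ℝ) (1 / 7), ∀ γ : Fin 7 → ℝ, BDF3System μ (1 / 2) γ →
      1 / 30000 ≤ γ 6 ^ 2 → (bdf3G μ (1 / 2) γ).PosDef := fun μ hμ γ hγ h6 =>
    posDef_of_le_weightedNormSq (isHermitian_bdf3G _ _ _) hc fun v => (hbound μ hμ γ hγ h6 v).1
  refine ⟨fun μ η γ h => h.sq_odd_coeff_sum, ?_, ⟨1 / 2, by norm_num, by norm_num, ?_⟩, ?_⟩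
  · rintro μ η hη hμ ⟨γ, h⟩
    have := h.sq_odd_coeff_sum
    nlinarith [sq_nonneg (γ 1 + γ 3 + γ 5)]
  · intro μ h0 h1
    obtain ⟨γ, hγ, h6⟩ := exists_bdf3System h0 h1
    exact ⟨γ, hγ, hpd μ ⟨h0, h1⟩ γ hγ h6⟩
  · intro X _ _ _ ω τ hω hω7 hτ
    have hex : ∀ μ : ℝ, ∃ γ : Fin 7 → ℝ, μ ∈ Set.Icc (0 : ℝ) (1 / 7) →
        BDF3System μ (1 / 2) γ ∧ 1 / 30000 ≤ γ 6 ^ 2 := fun μ => by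
      by_cases hμ : μ ∈ Set.Icc (0 : ℝ) (1 / 7)
      · exact (exists_bdf3System hμ.1 hμ.2).imp fun γ hγ _ => hγ
      · exact ⟨0, fun h => absurd h hμ⟩
    choose γ hγ using hex
    have hsub : Set.Icc 0 ω ⊆ Set.Icc (0 : ℝ) (1 / 7) := Set.Icc_subset_Icc_right hω7
    refine ⟨1 / 2, fun μ => bdf3G μ (1 / 2) (γ μ), γ,
      ⟨⟨by norm_num, by norm_num⟩, fun μ hμ => ⟨?_, ?_⟩⟩, ?_⟩
    · exact hpd μ (hsub hμ) _ (hγ μ (hsub hμ)).1 (hγ μ (hsub hμ)).2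
    · exact (hγ μ (hsub hμ)).1.energy_identity hτ.ne'
    · exact uniformEigenvalueBounds_of_forall hω.le hc (fun μ _ => isHermitian_bdf3G _ _ _)
        fun μ hμ => hbound μ (hsub hμ) _ (hγ μ (hsub hμ)).1 (hγ μ (hsub hμ)).2
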